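/- A \emph{Hadamard space} is a complete CAT(0) space, that is, a complete metric space $(X,d)$ in which every two points are joined by a geodesic segment and in which distances between points on the sides of any geodesic triangle are at most the corresponding distances in a Euclidean triangle with the same side lengths. For points $p\neq x\neq q$ of such a space, $\angle pxq\in[0,\pi]$ denotes the Alexandrov angle at $x$ between the geodesics $c$ from $x$ to $p$ and $c'$ from $x$ to $q$ (parametrized by arc length), namely $\limsup_{t,t'\downarrow 0}\bar\angle_x(c(t),c'(t'))$, where $\bar\angle_x(u,v)$ is the angle, at the vertex corresponding to $x$, of a Euclidean triangle with the same side lengths as the triangle $x,u,v$. Let $X$ be a Hadamard space and let $A\subset X$ be a nonempty finite set. The \emph{mean deficit} of $A$ is the function on $X\setminus A$ defined by \[ \mathrm{def}_A(x)\;=\;\max\Big\{\,\sup_{y\in X,\ y\neq x}\ \min_{a\in A}\ d(a,x)\cos\angle axy\,,\;0\Big\}\qquad (x\in X\setminus A). \] Then $\mathrm{def}_A$ is lower semicontinuous on $X\setminus A$, and for every real $\kappa\ge 0$ the set \[ A\ \cup\ \{x\in X\setminus A:\ \mathrm{def}_A(x)\le\kappa\} \] is closed and bounded. -/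

import Mathlib

open Filter Topology

noncomputable section

/-- `γ`, restricted to `[0, d(x, y)]`, is a (unit-speed) geodesic from `x` to `y`: an isometric
embedding of that interval with `γ 0 = x` and `γ (d(x, y)) = y`. Its image is a geodesic segment
joining `x` and `y`. Values of `γ` outside the interval are irrelevant. -/
structure IsGeodesic {X : Type*} [MetricSpace X] (γ : ℝ → X) (x y : X) : Prop where
  source : γ 0 = x
  target : γ (dist x y) = y
  isometry_on : ∀ s ∈ Set.Icc (0 : ℝ) (dist x y), ∀ t ∈ Set.Icc (0 : ℝ) (dist x y),
    dist (γ s) (γ t) = |s - t|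

/-- A geodesic space: every two points are joined by a geodesic segment. -/
class GeodesicMetricSpace (X : Type*) [MetricSpace X] : Prop where
  exists_geodesic : ∀ x y : X, ∃ γ : ℝ → X, IsGeodesic γ x y

/-- A CAT(0) space: a geodesic space in which distances between points on the sides of any geodesic
triangle are at most the corresponding distances in a comparison triangle in the Euclidean plane.

Two different sides of a triangle share a vertex, here called `x`; the sides are `[x, y]` and
`[x, z]`, and a third side exists because the space is geodesic (for two points on the same side
there is nothing to require). The point of `[x, y]` at distance `s * d(x, y)` from `x` corresponds
to the point `(1 - s) x' + s y'` of the comparison triangle `x' y' z'`. -/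
class CAT0Space (X : Type*) [MetricSpace X] : Prop extends GeodesicMetricSpace X where
  dist_le_comparison : ∀ (x y z : X) (σ τ : ℝ → X), IsGeodesic σ x y → IsGeodesic τ x z →
    ∀ x' y' z' : EuclideanSpace ℝ (Fin 2),
      dist x' y' = dist x y → dist x' z' = dist x z → dist y' z' = dist y z →
      ∀ s ∈ Set.Icc (0 : ℝ) 1, ∀ t ∈ Set.Icc (0 : ℝ) 1,
        dist (σ (s * dist x y)) (τ (t * dist x z)) ≤
          dist (AffineMap.lineMap x' y' s : EuclideanSpace ℝ (Fin 2)) (AffineMap.lineMap x' z' t)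

/-- A Hadamard space: a complete CAT(0) space. -/
class HadamardSpace (X : Type*) [MetricSpace X] : Prop extends CAT0Space X, CompleteSpace X

/-- The comparison angle at `x` between `p` and `q`: the angle at the vertex corresponding to `x`
in a Euclidean triangle with the same side lengths as `p`, `x`, `q` (for `p ≠ x ≠ q`). -/
def comparisonAngle {X : Type*} [MetricSpace X] (p x q : X) : ℝ :=
  Real.arccos ((dist x p ^ 2 + dist x q ^ 2 - dist p q ^ 2) / (2 * dist x p * dist x q))

/-- The comparison angle really is the Euclidean angle in any comparison triangle. -/
theorem comparisonAngle_eq_angle {X : Type*} [MetricSpace X] (p x q : X)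
    (p' x' q' : EuclideanSpace ℝ (Fin 2)) (h₁ : dist x' p' = dist x p)
    (h₂ : dist x' q' = dist x q) (h₃ : dist p' q' = dist p q) :
    comparisonAngle p x q = EuclideanGeometry.angle p' x' q' := by
  unfold comparisonAngle EuclideanGeometry.angle InnerProductGeometry.angle
  rw [← h₁, ← h₂, ← h₃, real_inner_eq_norm_mul_self_add_norm_mul_self_sub_norm_sub_mul_self_div_two]
  simp only [vsub_eq_sub, sub_sub_sub_cancel_right, ← dist_eq_norm, dist_comm x']
  congr 1
  rw [div_div]
  congr 1 <;> ring

/-- The Alexandrov (upper) angle at `x` between two geodesics `c`, `c'` issuing from `x`. -/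
def geodesicAngle {X : Type*} [MetricSpace X] (x : X) (c c' : ℝ → X) : ℝ :=
  limsup (fun u : ℝ × ℝ => comparisonAngle (c u.1) x (c' u.2)) (𝓝[>] 0 ×ˢ 𝓝[>] 0)

/-- The geodesic from `x` to `y`. -/
def geodesic {X : Type*} [MetricSpace X] [GeodesicMetricSpace X] (x y : X) : ℝ → X :=
  Classical.choose (GeodesicMetricSpace.exists_geodesic x y)

theorem isGeodesic_geodesic {X : Type*} [MetricSpace X] [GeodesicMetricSpace X] (x y : X) :
    IsGeodesic (geodesic x y) x y :=
  Classical.choose_spec (GeodesicMetricSpace.exists_geodesic x y)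

/-- In a CAT(0) space, geodesics are unique, so `geodesic x y` involves no real choice. -/
theorem IsGeodesic.unique {X : Type*} [MetricSpace X] [CAT0Space X] {x y : X} {σ τ : ℝ → X}
    (hσ : IsGeodesic σ x y) (hτ : IsGeodesic τ x y) {s : ℝ}
    (hs : s ∈ Set.Icc (0 : ℝ) (dist x y)) : σ s = τ s := by
  rcases eq_or_ne x y with rfl | hxy
  · obtain rfl : s = 0 := by simpa using hs
    rw [hσ.source, hτ.source]
  have hd : 0 < dist x y := dist_pos.2 hxy
  have hu : s / dist x y ∈ Set.Icc (0 : ℝ) 1 :=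
    ⟨div_nonneg hs.1 hd.le, (div_le_one hd).2 hs.2⟩
  have hy : dist (0 : EuclideanSpace ℝ (Fin 2)) (EuclideanSpace.single 0 (dist x y)) =
      dist x y := by simp
  have h := CAT0Space.dist_le_comparison x y y σ τ hσ hτ 0 (EuclideanSpace.single 0 (dist x y))
    (EuclideanSpace.single 0 (dist x y)) hy hy (by simp) _ hu _ hu
  rw [dist_self, div_mul_cancel₀ _ hd.ne'] at h
  exact dist_le_zero.1 h

/-- The Alexandrov angle `∠ p x q` at `x` between the geodesics `[x, p]` and `[x, q]`
(used only for `p ≠ x ≠ q`). -/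
def alexandrovAngle {X : Type*} [MetricSpace X] [GeodesicMetricSpace X] (p x q : X) : ℝ :=
  geodesicAngle x (geodesic x p) (geodesic x q)

/-- The mean deficit of a nonempty finite set `A` at a point `x ∉ A`:
the positive part of `sup_{y ≠ x} min_{a ∈ A} d(a, x) cos ∠ a x y`. -/
def meanDeficit {X : Type*} [MetricSpace X] [GeodesicMetricSpace X] (A : Finset X)
    (hA : A.Nonempty) (x : X) : ℝ :=
  max (⨆ y : {y : X // y ≠ x},
    A.inf' hA fun a => dist a x * Real.cos (alexandrovAngle a x y)) 0

/-- The supremum defining the mean deficit is over a set that is bounded above. -/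
theorem bddAbove_meanDeficit {X : Type*} [MetricSpace X] [GeodesicMetricSpace X] (A : Finset X)
    (hA : A.Nonempty) (x : X) :
    BddAbove (Set.range fun y : {y : X // y ≠ x} =>
      A.inf' hA fun a => dist a x * Real.cos (alexandrovAngle a x y)) := by
  obtain ⟨b, hb⟩ := hA
  refine ⟨dist b x, ?_⟩
  rintro _ ⟨y, rfl⟩
  exact (Finset.inf'_le _ hb).trans (mul_le_of_le_one_right dist_nonneg (Real.cos_le_one _))

end

/-! In a CAT(0) space the comparison angle of two geodesics from a point grows with the distances
along them, so the Alexandrov angle is bounded by the comparison angle at every scale. At a fixed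
scale the latter varies continuously with the vertex, hence the angle is upper semicontinuous there
(`eventually_alexandrovAngle_lt`). Thus `d(a, x) cos ∠ a x y` is lower semicontinuous in `x`, and
finite minima, suprema and the maximum with `0` preserve this. As `A` is closed, the sets in
question are closed. For boundedness, test the supremum with some `y = b ∈ A`: the cosine law bounds
every term below by about `d(x, b) / 2`, so the deficit exceeds `κ` far from `A`. -/

section Comparison

/-! ### Comparison triangles and monotonicity of angles -/

variable {X : Type*} [MetricSpace X]

/-- Three side lengths satisfying the triangle inequalities are realized in the plane, with one
vertex at the origin. -/
theorem exists_planar_triangle {a b e : ℝ} (ha : 0 ≤ a) (hb : 0 ≤ b) (he : 0 ≤ e)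
    (h₁ : a ≤ b + e) (h₂ : b ≤ a + e) (h₃ : e ≤ a + b) :
    ∃ u v : EuclideanSpace ℝ (Fin 2), ‖u‖ = a ∧ ‖v‖ = b ∧ ‖u - v‖ = e := by
  rcases ha.eq_or_lt with rfl | ha
  · obtain rfl : b = e := by linarith
    exact ⟨0, !₂[b, 0], by simp, by simp [EuclideanSpace.norm_eq, Real.sqrt_sq hb],
      by simp [EuclideanSpace.norm_eq, Real.sqrt_sq hb]⟩
  -- The first coordinate of `v` when `u` lies on the first axis, by the cosine law.
  set p : ℝ := (a ^ 2 + b ^ 2 - e ^ 2) / (2 * a) with hp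
  have hpa : 2 * a * p = a ^ 2 + b ^ 2 - e ^ 2 := by rw [hp]; field_simp
  have hpb : |p| ≤ b := by
    rw [abs_le]
    constructor
    · have : 0 ≤ 2 * a * (p + b) := by nlinarith
      nlinarith [nonneg_of_mul_nonneg_right this (by positivity)]
    · have : 0 ≤ 2 * a * (b - p) := by nlinarith
      nlinarith [nonneg_of_mul_nonneg_right this (by positivity)]
  have hq : √(b ^ 2 - p ^ 2) ^ 2 = b ^ 2 - p ^ 2 :=
    Real.sq_sqrt (sub_nonneg.2 (sq_le_sq.2 (by rwa [abs_of_nonneg hb])))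
  refine ⟨!₂[a, 0], !₂[p, √(b ^ 2 - p ^ 2)], ?_, ?_, ?_⟩
  · simp [EuclideanSpace.norm_eq, Real.sqrt_sq ha.le]
  · rw [EuclideanSpace.norm_eq, Real.sqrt_eq_iff_eq_sq (by positivity) hb]
    simp [hq]
  · rw [EuclideanSpace.norm_eq, Real.sqrt_eq_iff_eq_sq (by positivity) he]
    simp only [Fin.sum_univ_two, Real.norm_eq_abs, sq_abs]
    simp [hq]
    linarith

theorem IsGeodesic.dist_source {x y : X} {σ : ℝ → X} (h : IsGeodesic σ x y) {t : ℝ}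
    (ht : t ∈ Set.Icc 0 (dist x y)) : dist x (σ t) = t := by
  have := h.isometry_on 0 ⟨le_rfl, dist_nonneg⟩ t ht
  rwa [h.source, zero_sub, abs_neg, abs_of_nonneg ht.1] at this

theorem IsGeodesic.restrict {x y : X} {σ : ℝ → X} (h : IsGeodesic σ x y) {t : ℝ}
    (ht : t ∈ Set.Icc 0 (dist x y)) : IsGeodesic σ x (σ t) where
  source := h.source
  target := by rw [h.dist_source ht]
  isometry_on := by
    rw [h.dist_source ht]
    intro r hr s hs
    exact h.isometry_on r ⟨hr.1, hr.2.trans ht.2⟩ s ⟨hs.1, hs.2.trans ht.2⟩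

theorem IsGeodesic.reverse {x y : X} {σ : ℝ → X} (h : IsGeodesic σ x y) :
    IsGeodesic (fun t => σ (dist x y - t)) y x where
  source := by simp [h.target]
  target := by simp [dist_comm y x, h.source]
  isometry_on := by
    rw [dist_comm y x]
    intro r hr s hs
    rw [h.isometry_on _ ⟨by linarith [hr.2], by linarith [hr.1]⟩ _
      ⟨by linarith [hs.2], by linarith [hs.1]⟩, ← abs_neg]
    congr 1
    ring

/-- The CAT(0) inequality for points on two sides of a triangle, in terms of the side lengths. -/
theorem IsGeodesic.dist_sq_le [CAT0Space X] {x y z : X} {σ τ : ℝ → X} (hσ : IsGeodesic σ x y)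
    (hτ : IsGeodesic τ x z) {s t : ℝ} (hs : s ∈ Set.Icc (0 : ℝ) 1) (ht : t ∈ Set.Icc (0 : ℝ) 1) :
    dist (σ (s * dist x y)) (τ (t * dist x z)) ^ 2 ≤ s ^ 2 * dist x y ^ 2 + t ^ 2 * dist x z ^ 2 -
      s * t * (dist x y ^ 2 + dist x z ^ 2 - dist y z ^ 2) := by
  obtain ⟨u, v, hu, hv, huv⟩ := exists_planar_triangle (dist_nonneg (x := x) (y := y))
    (dist_nonneg (x := x) (y := z)) (dist_nonneg (x := y) (y := z))
    (by simpa [dist_comm z y] using dist_triangle x z y) (dist_triangle x y z)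
    (dist_triangle_left y z x)
  have h := CAT0Space.dist_le_comparison x y z σ τ hσ hτ 0 u v (by simpa using hu)
    (by simpa using hv) (by rwa [dist_eq_norm]) s hs t ht
  have h' := pow_le_pow_left₀ dist_nonneg h 2
  refine h'.trans (le_of_eq ?_)
  rw [AffineMap.lineMap_apply_module, AffineMap.lineMap_apply_module, dist_eq_norm, smul_zero,
    smul_zero, zero_add, zero_add, norm_sub_sq_real, norm_smul, norm_smul, inner_smul_left,
    inner_smul_right, ← hu, ← hv, ← huv, norm_sub_sq_real]
  simp only [Real.norm_eq_abs, mul_pow, sq_abs, conj_trivial]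
  ring

/-- In a CAT(0) space the comparison angle at the origin of two geodesics is monotone. -/
theorem IsGeodesic.comparisonAngle_le [CAT0Space X] {x y z : X} {σ τ : ℝ → X}
    (hσ : IsGeodesic σ x y) (hτ : IsGeodesic τ x z) {s t : ℝ} (hs : s ∈ Set.Ioc 0 (dist x y))
    (ht : t ∈ Set.Ioc 0 (dist x z)) :
    comparisonAngle (σ s) x (τ t) ≤ comparisonAngle y x z := by
  have hy : 0 < dist x y := hs.1.trans_le hs.2
  have hz : 0 < dist x z := ht.1.trans_le ht.2
  have h := hσ.dist_sq_le hτ (s := s / dist x y) (t := t / dist x z)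
    ⟨by have := hs.1; positivity, (div_le_one hy).2 hs.2⟩
    ⟨by have := ht.1; positivity, (div_le_one hz).2 ht.2⟩
  rw [div_mul_cancel₀ _ hy.ne', div_mul_cancel₀ _ hz.ne', div_pow, div_pow,
    div_mul_cancel₀ _ (by positivity), div_mul_cancel₀ _ (by positivity)] at h
  unfold comparisonAngle
  apply Real.arccos_le_arccos
  rw [hσ.dist_source ⟨hs.1.le, hs.2⟩, hτ.dist_source ⟨ht.1.le, ht.2⟩]
  have hs0 := hs.1
  have ht0 := ht.1
  rw [le_div_iff₀ (by positivity)]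
  calc _ = s / dist x y * (t / dist x z) * (dist x y ^ 2 + dist x z ^ 2 - dist y z ^ 2) := by
        field_simp
    _ ≤ _ := by linarith

theorem comparisonAngle_nonneg (p x q : X) : 0 ≤ comparisonAngle p x q := Real.arccos_nonneg _

theorem comparisonAngle_le_pi (p x q : X) : comparisonAngle p x q ≤ Real.pi := Real.arccos_le_pi _

theorem isBoundedUnder_comparisonAngle (x : X) (σ τ : ℝ → X) (l : Filter (ℝ × ℝ)) :
    l.IsBoundedUnder (· ≤ ·) fun u : ℝ × ℝ => comparisonAngle (σ u.1) x (τ u.2) :=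
  isBoundedUnder_of ⟨Real.pi, fun _ => comparisonAngle_le_pi _ _ _⟩

theorem isCoboundedUnder_comparisonAngle (x : X) (σ τ : ℝ → X) (l : Filter (ℝ × ℝ)) [l.NeBot] :
    l.IsCoboundedUnder (· ≤ ·) fun u : ℝ × ℝ => comparisonAngle (σ u.1) x (τ u.2) :=
  (isBoundedUnder_of ⟨0, fun _ => comparisonAngle_nonneg _ _ _⟩ :
    l.IsBoundedUnder (· ≥ ·) _).isCoboundedUnder_le

theorem eventually_mem_Ioc_prod {a b : ℝ} (ha : 0 < a) (hb : 0 < b) :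
    ∀ᶠ u : ℝ × ℝ in 𝓝[>] 0 ×ˢ 𝓝[>] 0, u.1 ∈ Set.Ioc 0 a ∧ u.2 ∈ Set.Ioc 0 b :=
  prod_mem_prod (Ioc_mem_nhdsGT ha) (Ioc_mem_nhdsGT hb)

theorem geodesicAngle_nonneg (x : X) (σ τ : ℝ → X) : 0 ≤ geodesicAngle x σ τ :=
  le_limsup_of_frequently_le (Eventually.frequently (.of_forall fun _ =>
    comparisonAngle_nonneg _ _ _)) (isBoundedUnder_comparisonAngle x σ τ _)

theorem IsGeodesic.geodesicAngle_le [CAT0Space X] {x y z : X} {σ τ : ℝ → X}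
    (hσ : IsGeodesic σ x y) (hτ : IsGeodesic τ x z) (hy : x ≠ y) (hz : x ≠ z) :
    geodesicAngle x σ τ ≤ comparisonAngle y x z := by
  refine limsup_le_of_le (isCoboundedUnder_comparisonAngle x σ τ _) ?_
  filter_upwards [eventually_mem_Ioc_prod (dist_pos.2 hy) (dist_pos.2 hz)] with u hu
  exact hσ.comparisonAngle_le hτ hu.1 hu.2

theorem alexandrovAngle_nonneg [GeodesicMetricSpace X] (p x q : X) : 0 ≤ alexandrovAngle p x q :=
  geodesicAngle_nonneg _ _ _

theorem alexandrovAngle_le_comparisonAngle [CAT0Space X] {p x q : X} (hp : x ≠ p) (hq : x ≠ q) :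
    alexandrovAngle p x q ≤ comparisonAngle p x q :=
  (isGeodesic_geodesic x p).geodesicAngle_le (isGeodesic_geodesic x q) hp hq

/-- The angle depends only on initial pieces of the geodesics, so they may be truncated at `s` and
`t`. -/
theorem alexandrovAngle_le_comparisonAngle_geodesic [CAT0Space X] {p x q : X} {s t : ℝ}
    (hs : s ∈ Set.Ioc 0 (dist x p)) (ht : t ∈ Set.Ioc 0 (dist x q)) :
    alexandrovAngle p x q ≤ comparisonAngle (geodesic x p s) x (geodesic x q t) := by
  have hs' := Set.Ioc_subset_Icc_self hs
  have ht' := Set.Ioc_subset_Icc_self ht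
  refine ((isGeodesic_geodesic x p).restrict hs').geodesicAngle_le
    ((isGeodesic_geodesic x q).restrict ht') ?_ ?_
  · rw [← dist_pos, (isGeodesic_geodesic x p).dist_source hs']
    exact hs.1
  · rw [← dist_pos, (isGeodesic_geodesic x q).dist_source ht']
    exact ht.1

/-! ### Semicontinuity of the angle in its vertex -/

/-- Geodesics with a common endpoint, parametrized by arc length from their origins, stay close
when their origins are close. -/
theorem IsGeodesic.dist_le_two_mul [CAT0Space X] {x y p : X} {σ τ : ℝ → X}
    (hσ : IsGeodesic σ x p) (hτ : IsGeodesic τ y p) {t : ℝ} (ht : 0 < t) (hx : t ≤ dist x p)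
    (hy : t ≤ dist y p) : dist (σ t) (τ t) ≤ 2 * dist x y := by
  have hxp : 0 < dist x p := ht.trans_le hx
  set r : ℝ := t / dist x p with hr
  have hr0 : 0 ≤ r := by positivity
  have hr1 : r ≤ 1 := (div_le_one hxp).2 hx
  have htr : t = r * dist x p := by rw [hr, div_mul_cancel₀ _ hxp.ne']
  have hmem : 1 - r ∈ Set.Icc (0 : ℝ) 1 := ⟨by linarith, by linarith⟩
  -- Compare at the common vertex `p`: points at equal ratio `r` are at most `dist x y` apart.
  -- Passing from ratio to arc length on `τ` costs another `dist x y`.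
  have h := hσ.reverse.dist_sq_le hτ.reverse hmem hmem
  have hle : dist (σ t) (τ (r * dist y p)) ≤ dist x y := by
    have e₁ : dist x p - (1 - r) * dist p x = t := by rw [dist_comm p x, htr]; ring
    have e₂ : dist y p - (1 - r) * dist p y = r * dist y p := by rw [dist_comm p y]; ring
    simp only [e₁, e₂] at h
    refine le_of_sq_le_sq ?_ dist_nonneg
    calc _ ≤ _ := h
      _ = (1 - r) ^ 2 * dist x y ^ 2 := by ring
      _ ≤ 1 * dist x y ^ 2 := by gcongr; exact pow_le_one₀ hmem.1 hmem.2
      _ = _ := one_mul _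
  have hmove : dist (τ (r * dist y p)) (τ t) ≤ dist x y := by
    rw [hτ.isometry_on _ ⟨by positivity, mul_le_of_le_one_left dist_nonneg hr1⟩ _ ⟨ht.le, hy⟩, htr,
      ← mul_sub, abs_mul, abs_of_nonneg hr0]
    calc r * |dist y p - dist x p| ≤ 1 * dist y x := by
          gcongr
          exact abs_dist_sub_le _ _ _
      _ = dist x y := by rw [one_mul, dist_comm]
  linarith [dist_triangle (σ t) (τ (r * dist y p)) (τ t)]

theorem tendsto_geodesic_source [CAT0Space X] {x p : X} {t : ℝ} (ht : 0 < t) (htx : t < dist x p) :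
    Tendsto (fun y => geodesic y p t) (𝓝 x) (𝓝 (geodesic x p t)) := by
  have hd : Tendsto (fun y => dist y p) (𝓝 x) (𝓝 (dist x p)) :=
    (continuous_id.dist continuous_const).tendsto x
  have h0 : Tendsto (fun y => 2 * dist y x) (𝓝 x) (𝓝 0) := by
    have := ((continuous_id.dist continuous_const).const_mul 2 :
      Continuous fun y : X => 2 * dist y x).tendsto x
    simpa using this
  refine tendsto_iff_dist_tendsto_zero.2 (squeeze_zero' (.of_forall fun _ => dist_nonneg) ?_ h0)
  filter_upwards [hd.eventually_const_lt htx] with y hy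
  exact (isGeodesic_geodesic y p).dist_le_two_mul (isGeodesic_geodesic x p) ht hy.le htx.le

/-- The Alexandrov angle is upper semicontinuous in its vertex. -/
theorem eventually_alexandrovAngle_lt [CAT0Space X] {p x q : X} (hp : x ≠ p) (hq : x ≠ q) {θ : ℝ}
    (hθ : alexandrovAngle p x q < θ) : ∀ᶠ y in 𝓝 x, alexandrovAngle p y q < θ := by
  have hlt := eventually_lt_of_limsup_lt hθ (isBoundedUnder_comparisonAngle x _ _ _)
  -- Halving makes `s` and `t` strictly shorter than the geodesics, so the same scale works for
  -- nearby vertices.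
  obtain ⟨⟨s, t⟩, hst, hmem⟩ := (hlt.and (eventually_mem_Ioc_prod
    (half_pos (dist_pos.2 hp)) (half_pos (dist_pos.2 hq)))).exists
  obtain ⟨⟨hs0, hs⟩, ht0, ht⟩ := hmem
  have hsp : s < dist x p := hs.trans_lt (half_lt_self (dist_pos.2 hp))
  have htq : t < dist x q := ht.trans_lt (half_lt_self (dist_pos.2 hq))
  have hcp := tendsto_geodesic_source hs0 hsp
  have hcq := tendsto_geodesic_source ht0 htq
  have hne : 2 * dist x (geodesic x p s) * dist x (geodesic x q t) ≠ 0 := by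
    rw [(isGeodesic_geodesic x p).dist_source ⟨hs0.le, hsp.le⟩,
      (isGeodesic_geodesic x q).dist_source ⟨ht0.le, htq.le⟩]
    positivity
  have hlim : Tendsto (fun y => comparisonAngle (geodesic y p s) y (geodesic y q t)) (𝓝 x)
      (𝓝 (comparisonAngle (geodesic x p s) x (geodesic x q t))) :=
    (Real.continuous_arccos.tendsto _).comp
      (((((tendsto_id.dist hcp).pow 2).add ((tendsto_id.dist hcq).pow 2)).sub
        ((hcp.dist hcq).pow 2)).div (((tendsto_id.dist hcp).const_mul 2).mul
          (tendsto_id.dist hcq)) hne)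
  have hdp : Tendsto (fun y => dist y p) (𝓝 x) (𝓝 (dist x p)) := tendsto_id.dist tendsto_const_nhds
  have hdq : Tendsto (fun y => dist y q) (𝓝 x) (𝓝 (dist x q)) := tendsto_id.dist tendsto_const_nhds
  filter_upwards [hlim.eventually_lt_const hst, hdp.eventually_const_lt hsp,
    hdq.eventually_const_lt htq] with y h hyp hyq
  exact (alexandrovAngle_le_comparisonAngle_geodesic ⟨hs0, hyp.le⟩ ⟨ht0, hyq.le⟩).trans_lt h

theorem alexandrovAngle_le_pi [GeodesicMetricSpace X] (p x q : X) :
    alexandrovAngle p x q ≤ Real.pi :=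
  limsup_le_of_le (isCoboundedUnder_comparisonAngle x _ _ _)
    (.of_forall fun _ => comparisonAngle_le_pi _ _ _)

theorem lowerSemicontinuousAt_cos_alexandrovAngle [CAT0Space X] {p x q : X} (hp : x ≠ p)
    (hq : x ≠ q) : LowerSemicontinuousAt (fun y => Real.cos (alexandrovAngle p y q)) x := by
  intro c hc
  rcases lt_or_ge c (-1) with hc1 | hc1
  · exact .of_forall fun _ => hc1.trans_le (Real.neg_one_le_cos _)
  have hc2 : c ≤ 1 := hc.le.trans (Real.cos_le_one _)
  have key (y : X) : alexandrovAngle p y q < Real.arccos c ↔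
      c < Real.cos (alexandrovAngle p y q) := by
    conv_rhs => rw [← Real.cos_arccos hc1 hc2]
    exact (Real.strictAntiOn_cos.lt_iff_gt ⟨Real.arccos_nonneg _, Real.arccos_le_pi _⟩
      ⟨alexandrovAngle_nonneg _ _ _, alexandrovAngle_le_pi _ _ _⟩).symm
  simp only [← key] at hc ⊢
  exact eventually_alexandrovAngle_lt hp hq hc

theorem eventually_lt_dist_mul_cos_alexandrovAngle [CAT0Space X] {p x q : X} (hp : x ≠ p)
    (hq : x ≠ q) {c : ℝ} (hc : c < dist p x * Real.cos (alexandrovAngle p x q)) :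
    ∀ᶠ y in 𝓝 x, c < dist p y * Real.cos (alexandrovAngle p y q) := by
  have hpx : 0 < dist p x := dist_pos.2 hp.symm
  have hc' : c / dist p x < Real.cos (alexandrovAngle p x q) := by rwa [div_lt_iff₀' hpx]
  -- The gap between `c / dist p x` and `m` absorbs the variation of `dist p y`.
  obtain ⟨m, hcm, hm⟩ := exists_between hc'
  have hd : Tendsto (fun y => dist p y) (𝓝 x) (𝓝 (dist p x)) := tendsto_const_nhds.dist tendsto_id
  have hcm' : c < dist p x * m := by rwa [div_lt_iff₀' hpx] at hcm
  filter_upwards [lowerSemicontinuousAt_cos_alexandrovAngle hp hq m hm,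
    (hd.mul_const m).eventually_const_lt hcm'] with y h₁ h₂
  exact h₂.trans_le (mul_le_mul_of_nonneg_left h₁.le dist_nonneg)

end Comparison

/-! ### Semicontinuity and growth of the mean deficit -/

section MeanDeficit

variable {X : Type*} [MetricSpace X] {A : Finset X} {hA : A.Nonempty}

theorem lt_meanDeficit [GeodesicMetricSpace X] {x y : X} (hy : y ≠ x) {c : ℝ}
    (h : ∀ a ∈ A, c < dist a x * Real.cos (alexandrovAngle a x y)) : c < meanDeficit A hA x :=
  (((Finset.lt_inf'_iff hA).2 h).trans_le
    (le_ciSup (bddAbove_meanDeficit A hA x) ⟨y, hy⟩)).trans_le (le_max_left _ _)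

theorem exists_of_lt_meanDeficit [GeodesicMetricSpace X] {x : X} (hx : x ∉ A) {c : ℝ} (hc : 0 ≤ c)
    (h : c < meanDeficit A hA x) :
    ∃ y ≠ x, ∀ a ∈ A, c < dist a x * Real.cos (alexandrovAngle a x y) := by
  obtain ⟨b, hb⟩ := id hA
  -- `x ∉ A` makes the index type of the supremum nonempty.
  have : Nonempty {y : X // y ≠ x} := ⟨⟨b, ne_of_mem_of_not_mem hb hx⟩⟩
  rcases lt_max_iff.1 h with h | h
  · obtain ⟨⟨y, hy⟩, hlt⟩ := exists_lt_of_lt_ciSup h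
    exact ⟨y, hy, (Finset.lt_inf'_iff hA).1 hlt⟩
  · exact absurd h hc.not_gt

theorem eventually_lt_meanDeficit [CAT0Space X] {x : X} (hx : x ∉ A) {c : ℝ}
    (hc : c < meanDeficit A hA x) : ∀ᶠ z in 𝓝 x, c < meanDeficit A hA z := by
  rcases lt_or_ge c 0 with hc0 | hc0
  · exact .of_forall fun _ => hc0.trans_le (le_max_right _ _)
  obtain ⟨y, hyx, hy⟩ := exists_of_lt_meanDeficit hx hc0 hc
  have hall := (A.eventually_all (l := 𝓝 x)).2 fun a ha =>
    eventually_lt_dist_mul_cos_alexandrovAngle (ne_of_mem_of_not_mem ha hx).symm hyx.symm (hy a ha)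
  filter_upwards [hall, isOpen_ne.mem_nhds hyx.symm] with z hz hzy
  exact lt_meanDeficit (Ne.symm hzy) hz

/-- Replace the angle by the larger comparison angle, apply the cosine law and drop `dist x a ^ 2`.
-/
theorem le_dist_mul_cos_alexandrovAngle [CAT0Space X] {a b x : X} (ha : x ≠ a) (hb : x ≠ b) :
    (dist x b ^ 2 - dist a b ^ 2) / (2 * dist x b) ≤
      dist a x * Real.cos (alexandrovAngle a x b) := by
  have hxa : 0 < dist x a := dist_pos.2 ha
  have hxb : 0 < dist x b := dist_pos.2 hb
  have hcos := Real.cos_le_cos_of_nonneg_of_le_pi (alexandrovAngle_nonneg a x b)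
    (comparisonAngle_le_pi a x b) (alexandrovAngle_le_comparisonAngle ha hb)
  have htri₁ : dist a b ≤ dist x a + dist x b := dist_triangle_left a b x
  have htri₂ : |dist x a - dist x b| ≤ dist a b := by
    simpa [dist_comm x] using abs_dist_sub_le a b x
  rw [comparisonAngle, Real.cos_arccos] at hcos
  · refine le_trans ?_ (mul_le_mul_of_nonneg_left hcos dist_nonneg)
    rw [dist_comm a x]
    calc _ ≤ (dist x a ^ 2 + dist x b ^ 2 - dist a b ^ 2) / (2 * dist x b) := by
          gcongr
          linarith [sq_nonneg (dist x a)]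
      _ = _ := by field_simp
  · rw [le_div_iff₀ (by positivity)]
    nlinarith [pow_le_pow_left₀ dist_nonneg htri₁ 2]
  · rw [div_le_one (by positivity)]
    have := pow_le_pow_left₀ (abs_nonneg _) htri₂ 2
    rw [sq_abs] at this
    nlinarith

theorem exists_dist_le_of_meanDeficit_le [CAT0Space X] {b : X} (hb : b ∈ A) {κ : ℝ} (hκ : 0 ≤ κ) :
    ∃ R, ∀ x, x ∉ A → meanDeficit A hA x ≤ κ → dist x b ≤ R := by
  obtain ⟨D, hD⟩ := Metric.isBounded_iff.1 A.finite_toSet.isBounded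
  have hD0 : 0 ≤ D := dist_nonneg.trans (hD hb hb)
  -- If `d = dist x b` exceeds this, then `d * (d - 2 * κ) > d * (D + 1) ≥ D ^ 2`.
  refine ⟨2 * κ + D + 1, fun x hx => le_imp_le_of_lt_imp_lt fun hlt => ?_⟩
  refine lt_meanDeficit (ne_of_mem_of_not_mem hb hx) fun a ha => ?_
  refine lt_of_lt_of_le ?_ (le_dist_mul_cos_alexandrovAngle (ne_of_mem_of_not_mem ha hx).symm
    (ne_of_mem_of_not_mem hb hx).symm)
  rw [lt_div_iff₀ (by linarith)]
  have := pow_le_pow_left₀ dist_nonneg (hD ha hb) 2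
  nlinarith

end MeanDeficit

theorem mainTheorem11 {X : Type*} [MetricSpace X] [HadamardSpace X] (A : Finset X)
    (hA : A.Nonempty) :
    LowerSemicontinuousOn (meanDeficit A hA) (A : Set X)ᶜ ∧
      ∀ κ : ℝ, 0 ≤ κ →
        IsClosed ((A : Set X) ∪ {x : X | x ∉ A ∧ meanDeficit A hA x ≤ κ}) ∧
          Bornology.IsBounded ((A : Set X) ∪ {x : X | x ∉ A ∧ meanDeficit A hA x ≤ κ}) := by
  refine ⟨fun x hx c hc => (eventually_lt_meanDeficit hx hc).filter_mono nhdsWithin_le_nhds,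
    fun κ hκ => ⟨?_, A.finite_toSet.isBounded.union ?_⟩⟩
  · rw [← isOpen_compl_iff, isOpen_iff_mem_nhds]
    intro x hx
    have hxA : x ∉ A := fun h => hx (.inl h)
    have hxκ : κ < meanDeficit A hA x := not_le.1 fun h => hx (.inr ⟨hxA, h⟩)
    filter_upwards [eventually_lt_meanDeficit hxA hxκ,
      A.finite_toSet.isClosed.isOpen_compl.mem_nhds hxA] with z hz hzA
    rintro (h | h)
    · exact hzA h
    · exact hz.not_ge h.2
  · obtain ⟨b, hb⟩ := id hA
    obtain ⟨R, hR⟩ := exists_dist_le_of_meanDeficit_le (hA := hA) hb hκ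
    exact Metric.isBounded_closedBall.subset fun x hx =>
      Metric.mem_closedBall.2 (hR x hx.1 hx.2)
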